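/- Let $\Omega\subset\mathbb R^k$ be compact and equal to the closure of its interior, let $p>1$ and $d\ge 1$ be real numbers, and let $\mu$ be a Borel probability measure on $\Omega$ that is strongly $d$-connected: there are $L,K>0$, an integer $N\ge 2$ and a measure space $(D,\beta)$ with $0<\beta(D)<\infty$ such that for all $x_0,x_1\in\operatorname{supp}\mu$ there are $m\le N$ points $y_1=x_0,y_2,\dots,y_m=x_1$ in $\operatorname{supp}\mu$ and measurable maps $\Phi_j:[0,1]\times D\to\operatorname{supp}\mu$, $1\le j\le m-1$, such that (i) $s\mapsto\Phi_j(s,b)$ is $L$-Lipschitz for every $b\in D$; (ii) $\Phi_j$ is injective on $(0,1)\times D$, and $\Phi_j(0,b)=y_j$, $\Phi_j(1,b)=y_{j+1}$ for every $b\in D$; (iii) the image under $\Phi_j$ of the measure $K s^{d-1}(1-s)^{d-1}\,ds\,\beta(db)$ is $\le\mu$. For nonnegative measures $\mu_1,\mu_2$ of equal finite mass put $W_p(\mu_1,\mu_2)=\big(\inf_\pi\int|x-y|^p\,\pi(dx\,dy)\big)^{1/p}$, the infimum being over the measures $\pi$ on $\Omega\times\Omega$ with marginals $\mu_1$ and $\mu_2$.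 For a finite signed Borel measure $\nu$ on $\Omega$ let $\nu=\nu_+-\nu_-$ be its Jordan decomposition and $\|\nu\|_{TV}=\nu_+(\Omega)+\nu_-(\Omega)$. Then there is a constant $\bar C>0$, depending only on $\mu$, $p$ and $d$, such that for every finite signed Borel measure $\nu$ on $\Omega$ with $\nu(\Omega)=0$, $\operatorname{supp}\nu\subset\operatorname{supp}\mu$, $\mu+\nu\ge 0$ and $\nu_-\le\mu/2$: - if $\frac1d+\frac1p\ne 1$ (that is, $p\neq d/(d-1)$), then $$W_p(\mu+\nu,\mu)\le\bar C\,\|\nu\|_{TV}^{q},\qquad q=\min\Big(1,\frac1d+\frac1p\Big);$$ - if $\frac1d+\frac1p=1$ (that is, $p=d/(d-1)$), then $$W_p(\mu+\nu,\mu)\le\bar C\,\|\nu\|_{TV}\,\ln\big(\|\nu\|_{TV}^{-1}+1\big),$$ where the right-hand side is read as $0$ for $\nu=0$. -/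

import Mathlib

open MeasureTheory Set
open scoped ENNReal NNReal unitInterval

noncomputable section

/-- The `p`-Wasserstein distance between two nonnegative measures of equal mass: the infimum runs
over all transport plans `π` with first marginal `μ₁` and second marginal `μ₂`. (For measures of
different mass there is no plan, and the value is `∞`.) -/
def wassersteinDist {X : Type*} [PseudoEMetricSpace X] [MeasurableSpace X]
    (p : ℝ) (μ₁ μ₂ : Measure X) : ℝ≥0∞ :=
  (⨅ π ∈ {π : Measure (X × X) | π.fst = μ₁ ∧ π.snd = μ₂},
    ∫⁻ z, edist z.1 z.2 ^ p ∂π) ^ (1 / p)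

/-- The total variation norm `‖ν‖_TV = ν₊(X) + ν₋(X)` of a signed measure. -/
def tvNorm {X : Type*} [MeasurableSpace X] (ν : SignedMeasure X) : ℝ :=
  ν.totalVariation.real univ

/-- The measure `K s^(d-1) (1-s)^(d-1) ds dβ` on `[0,1] × D`. -/
def tubeMeasure {D : Type*} [MeasurableSpace D] (d K : ℝ) (β : Measure D) : Measure (I × D) :=
  ((volume : Measure I).prod β).withDensity fun z =>
    ENNReal.ofReal (K * (z.1 : ℝ) ^ (d - 1) * (1 - (z.1 : ℝ)) ^ (d - 1))

/-- `μ` is strongly `d`-connected: for some `L, K > 0`, `N ≥ 2` and a finite nonzero measure space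
`(D, β)`, any two points of `supp μ` are joined by a chain `y 0, …, y n` of at most `N` points of
`supp μ`, consecutive ones being joined by a bundle `Φ j : [0,1] × D → supp μ` of `L`-Lipschitz
curves, injective on `(0,1) × D`, that pushes `K s^(d-1) (1-s)^(d-1) ds dβ` to a measure `≤ μ`.
As the bundles are injective, it is no restriction to take `D` in the lowest universe. -/
def IsStronglyConnectedMeasure {X : Type*} [PseudoEMetricSpace X] [MeasurableSpace X]
    (d : ℝ) (μ : Measure X) : Prop :=
  ∃ (L : ℝ≥0) (K : ℝ) (N : ℕ) (D : Type) (_ : MeasurableSpace D) (β : Measure D),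
    0 < L ∧ 0 < K ∧ 2 ≤ N ∧ IsFiniteMeasure β ∧ β ≠ 0 ∧
    ∀ x₀ ∈ μ.support, ∀ x₁ ∈ μ.support,
      ∃ (n : ℕ) (y : Fin (n + 1) → X) (Φ : Fin n → I × D → X),
        n + 1 ≤ N ∧ y 0 = x₀ ∧ y (Fin.last n) = x₁ ∧ (∀ j, y j ∈ μ.support) ∧
        ∀ j : Fin n,
          Measurable (Φ j) ∧ (∀ z, Φ j z ∈ μ.support) ∧
          (∀ b : D, LipschitzWith L fun s : I => Φ j (s, b)) ∧
          InjOn (Φ j) (Ioo 0 1 ×ˢ univ) ∧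
          (∀ b : D, Φ j (0, b) = y j.castSucc) ∧
          (∀ b : D, Φ j (1, b) = y j.succ) ∧
          (tubeMeasure d K β).map (Φ j) ≤ μ

end

/-! With `ν = P - Q` the Jordan decomposition and `ρ = μ - Q`, the measures to be compared are `ρ +
P` and `ρ + Q`, where `ρ ≥ μ/2` and `P`, `Q` have equal mass `m`. It is enough to carry each of them
cheaply to `ρ + m δ_y` for one fixed `y` in the support.

For an atom `m δ_x`, no mass needs to travel the whole way: along a bundle of curves every particle
of `ρ` moves a little, so that the atom is absorbed at one end and an equal mass is released at the
other. Near its start a bundle carries at least `c d s^(d-1) ds` per unit of `β`, with quantile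
function `G u = (u/c)^(1/d)`, and the motion shifts the argument of `G` by `a`, proportional to `m`
(`HasPlan.half_tube`). The second half of a bundle is the first one reversed, and chaining at most
`N` points costs a constant factor (`IsStronglyConnectedMeasure.exists_hasPlan_atoms`). A general
measure is nearly a convex combination of atoms of full mass `m`, and cost bounds survive convex
combinations (`HasPlan.of_atoms`).

What remains is `∫ |G(v+a) - G(v)|^p dv`. The part `v ≤ a` contributes `a^(p/d+1)`, the rest `a^p
∫_a v^(p/d-p) dv`. Convergence of this integral at `0` is decided by the sign of `1/d + 1/p - 1`,
whence the two exponents and the critical logarithm. -/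

/-! ### Calculus of transport plans with a cost bound -/

/-- There is a transport plan from `μ₁` to `μ₂` whose total `p`-cost is at most `c`. -/
def HasPlan {X : Type*} [PseudoEMetricSpace X] [MeasurableSpace X]
    (p : ℝ) (μ₁ μ₂ : Measure X) (c : ℝ≥0∞) : Prop :=
  ∃ π : Measure (X × X), π.fst = μ₁ ∧ π.snd = μ₂ ∧ ∫⁻ z, edist z.1 z.2 ^ p ∂π ≤ c

namespace HasPlan

section Basic

variable {X : Type*} [PseudoEMetricSpace X] [MeasurableSpace X] {p : ℝ}
  {μ₁ μ₂ μ₃ μ₄ : Measure X} {c c' : ℝ≥0∞}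

theorem mono (h : HasPlan p μ₁ μ₂ c) (hc : c ≤ c') : HasPlan p μ₁ μ₂ c' :=
  let ⟨π, h₁, h₂, h₃⟩ := h
  ⟨π, h₁, h₂, h₃.trans hc⟩

theorem wassersteinDist_le (h : HasPlan p μ₁ μ₂ c) (hp : 0 < p) :
    wassersteinDist p μ₁ μ₂ ≤ c ^ (1 / p) := by
  obtain ⟨π, h₁, h₂, h₃⟩ := h
  refine ENNReal.rpow_le_rpow ?_ (by positivity)
  exact (iInf₂_le π ⟨h₁, h₂⟩).trans h₃

theorem zero : HasPlan p (0 : Measure X) 0 0 := ⟨0, by simp, by simp, by simp⟩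

theorem add (h : HasPlan p μ₁ μ₂ c) (h' : HasPlan p μ₃ μ₄ c') :
    HasPlan p (μ₁ + μ₃) (μ₂ + μ₄) (c + c') := by
  obtain ⟨π, h₁, h₂, h₃⟩ := h
  obtain ⟨π', h₁', h₂', h₃'⟩ := h'
  refine ⟨π + π', ?_, ?_, ?_⟩
  · rw [← h₁, ← h₁', Measure.fst, Measure.map_add _ _ measurable_fst]; rfl
  · rw [← h₂, ← h₂', Measure.snd, Measure.map_add _ _ measurable_snd]; rfl
  · rw [lintegral_add_measure]; exact add_le_add h₃ h₃'

theorem smul (h : HasPlan p μ₁ μ₂ c) (r : ℝ≥0∞) : HasPlan p (r • μ₁) (r • μ₂) (r * c) := by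
  obtain ⟨π, h₁, h₂, h₃⟩ := h
  refine ⟨r • π, ?_, ?_, ?_⟩
  · rw [← h₁, Measure.fst, Measure.map_smul]; rfl
  · rw [← h₂, Measure.snd, Measure.map_smul]; rfl
  · rw [lintegral_smul_measure]; exact mul_le_mul_right h₃ r

theorem sum {ι : Type*} (s : Finset ι) (μ ν : ι → Measure X) (c : ι → ℝ≥0∞)
    (h : ∀ i ∈ s, HasPlan p (μ i) (ν i) (c i)) :
    HasPlan p (∑ i ∈ s, μ i) (∑ i ∈ s, ν i) (∑ i ∈ s, c i) := by
  classical
  induction s using Finset.induction_on with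
  | empty => simpa using zero
  | insert i s hi ih =>
    rw [Finset.sum_insert hi, Finset.sum_insert hi, Finset.sum_insert hi]
    exact (h i (by simp)).add (ih fun j hj => h j (by simp [hj]))

end Basic

section Borel

variable {X : Type*} [PseudoEMetricSpace X] [MeasurableSpace X] [OpensMeasurableSpace X]
  [SecondCountableTopology X] {p : ℝ} {μ₁ μ₂ μ₃ : Measure X} {c c' : ℝ≥0∞}

theorem of_map {S : Type*} [MeasurableSpace S] (τ : Measure S) {f g : S → X}
    (hf : Measurable f) (hg : Measurable g) :
    HasPlan p (τ.map f) (τ.map g) (∫⁻ s, edist (f s) (g s) ^ p ∂τ) := by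
  have hfg := hf.prodMk hg
  refine ⟨τ.map fun s => (f s, g s), ?_, ?_, ?_⟩
  · rw [Measure.fst, Measure.map_map measurable_fst hfg]; rfl
  · rw [Measure.snd, Measure.map_map measurable_snd hfg]; rfl
  · rw [lintegral_map (by fun_prop) hfg]

theorem refl (hp : 0 < p) (μ : Measure X) : HasPlan p μ μ 0 := by
  have := of_map (p := p) μ (measurable_id (α := X)) measurable_id
  simpa [hp] using this

theorem symm (h : HasPlan p μ₁ μ₂ c) : HasPlan p μ₂ μ₁ c := by
  obtain ⟨π, h₁, h₂, h₃⟩ := h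
  have := of_map (p := p) π measurable_snd measurable_fst
  rw [← h₁, ← h₂]
  refine this.mono ?_
  simpa only [edist_comm] using h₃

-- Gluing: both plans are disintegrated over the middle marginal and coupled conditionally
-- independently. The factor comes from convexity of `t ↦ t ^ p`.
open scoped ProbabilityTheory in
theorem trans [StandardBorelSpace X] [Nonempty X] [IsFiniteMeasure μ₂] (hp : 1 ≤ p)
    (h : HasPlan p μ₁ μ₂ c) (h' : HasPlan p μ₂ μ₃ c') :
    HasPlan p μ₁ μ₃ (2 ^ (p - 1) * (c + c')) := by
  obtain ⟨π, h₁, h₂, h₃⟩ := h.symm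
  obtain ⟨π', h₁', h₂', h₃'⟩ := h'
  have : IsFiniteMeasure π := by
    constructor
    rw [← Measure.fst_univ, h₁]; exact measure_lt_top _ _
  have : IsFiniteMeasure π' := by
    constructor
    rw [← Measure.fst_univ, h₁']; exact measure_lt_top _ _
  let κ := π.condKernel
  let κ' := π'.condKernel
  have hκ : μ₂ ⊗ₘ κ = π := by rw [← h₁]; exact π.disintegrate _
  have hκ' : μ₂ ⊗ₘ κ' = π' := by rw [← h₁']; exact π'.disintegrate _
  let τ : Measure (X × X × X) := μ₂ ⊗ₘ (κ ×ₖ κ')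
  have e₁ : τ.map (fun z => (z.1, z.2.1)) = π := by
    rw [← hκ]
    ext s hs
    rw [Measure.map_apply (by fun_prop) hs, Measure.compProd_apply (hs.preimage (by fun_prop)),
      Measure.compProd_apply hs]
    refine lintegral_congr fun x => ?_
    rw [← ProbabilityTheory.Kernel.fst_prod κ κ',
      ProbabilityTheory.Kernel.fst_apply' _ _ (hs.preimage (by fun_prop)),
      ProbabilityTheory.Kernel.fst_prod]
    rfl
  have e₂ : τ.map (fun z => (z.1, z.2.2)) = π' := by
    rw [← hκ']
    ext s hs
    rw [Measure.map_apply (by fun_prop) hs, Measure.compProd_apply (hs.preimage (by fun_prop)),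
      Measure.compProd_apply hs]
    refine lintegral_congr fun x => ?_
    rw [← ProbabilityTheory.Kernel.snd_prod κ κ',
      ProbabilityTheory.Kernel.snd_apply' _ _ (hs.preimage (by fun_prop)),
      ProbabilityTheory.Kernel.snd_prod]
    rfl
  have key := of_map (p := p) τ (f := fun z => z.2.1) (g := fun z => z.2.2)
    (by fun_prop) (by fun_prop)
  have m₁ : τ.map (fun z => z.2.1) = μ₁ := by
    rw [← h₂, ← e₁, Measure.snd, Measure.map_map measurable_snd (by fun_prop)]; rfl
  have m₂ : τ.map (fun z => z.2.2) = μ₃ := by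
    rw [← h₂', ← e₂, Measure.snd, Measure.map_map measurable_snd (by fun_prop)]; rfl
  rw [m₁, m₂] at key
  refine key.mono ?_
  calc ∫⁻ s, edist s.2.1 s.2.2 ^ p ∂τ
      ≤ ∫⁻ s, 2 ^ (p - 1) * (edist s.1 s.2.1 ^ p + edist s.1 s.2.2 ^ p) ∂τ := by
        refine lintegral_mono fun s => ?_
        refine le_trans (ENNReal.rpow_le_rpow (edist_triangle_left s.2.1 s.2.2 s.1) (by linarith)) ?_
        exact ENNReal.rpow_add_le_mul_rpow_add_rpow _ _ hp
    _ = 2 ^ (p - 1) * (∫⁻ s, edist s.1 s.2.1 ^ p ∂τ + ∫⁻ s, edist s.1 s.2.2 ^ p ∂τ) := by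
        rw [lintegral_const_mul _ (by fun_prop), lintegral_add_left (by fun_prop)]
    _ ≤ 2 ^ (p - 1) * (c + c') := by
        gcongr
        · rw [← e₁, lintegral_map (by fun_prop) (by fun_prop)] at h₃
          exact h₃
        · rw [← e₂, lintegral_map (by fun_prop) (by fun_prop)] at h₃'
          exact h₃'

theorem trans_same [StandardBorelSpace X] [Nonempty X] [IsFiniteMeasure μ₂] (hp : 1 ≤ p)
    (h : HasPlan p μ₁ μ₂ c) (h' : HasPlan p μ₂ μ₃ c) : HasPlan p μ₁ μ₃ (2 ^ p * c) := by
  refine (h.trans hp h').mono (le_of_eq ?_)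
  have e : (2 : ℝ≥0∞) ^ p = 2 ^ (p - 1) * 2 := by
    conv_lhs => rw [show p = (p - 1) + 1 by ring]
    rw [ENNReal.rpow_add _ _ (by norm_num) (by norm_num), ENNReal.rpow_one]
  rw [e]
  ring

theorem _root_.ENNReal.one_le_two_rpow (hp : 1 ≤ p) : (1 : ℝ≥0∞) ≤ 2 ^ p :=
  ENNReal.one_le_rpow (by norm_num) (by linarith)

/-- Chains of `n` plans of equal cost. -/
theorem chain [StandardBorelSpace X] [Nonempty X] (hp : 1 ≤ p) {n : ℕ}
    (μ : Fin (n + 1) → Measure X) [∀ i, IsFiniteMeasure (μ i)]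
    (h : ∀ j : Fin n, HasPlan p (μ j.castSucc) (μ j.succ) c) :
    HasPlan p (μ 0) (μ (Fin.last n)) ((2 ^ p) ^ n * c) := by
  induction n with
  | zero => exact (refl (by linarith) _).mono zero_le
  | succ n ih =>
    have h₁ := ih (fun i => μ i.castSucc) fun j => h j.castSucc
    have h₂ := (h (Fin.last n)).mono
      (le_mul_of_one_le_left' (one_le_pow₀ (n := n) (ENNReal.one_le_two_rpow hp)))
    exact (h₁.trans_same hp h₂).mono (le_of_eq (by ring))

end Borel

end HasPlan

/-! ### The one-dimensional shift -/

/-- The quantile function of the measure `c d s^(d-1) ds` on `[0, 1/2]`, extended by constants. -/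
noncomputable def halfQuantile (c d u : ℝ) : I :=
  ⟨max 0 (min (1 / 2) ((max u 0 / c) ^ (1 / d))), le_max_left _ _,
    max_le zero_le_one ((min_le_left _ _).trans (by norm_num))⟩

@[fun_prop]
theorem measurable_halfQuantile (c d : ℝ) : Measurable (halfQuantile c d) := by
  unfold halfQuantile
  fun_prop

theorem halfQuantile_of_nonpos {c d u : ℝ} (hd : 0 < d) (hu : u ≤ 0) :
    halfQuantile c d u = 0 := by
  apply Subtype.ext
  have : 1 / d ≠ 0 := by positivity
  have h : (d⁻¹) ≠ 0 := by positivity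
  simp [halfQuantile, max_eq_right hu, Real.zero_rpow h]

theorem halfQuantile_of_mem {c d u : ℝ} (hc : 0 < c) (hd : 0 < d) (hu : 0 ≤ u)
    (hu' : u ≤ c / 2 ^ d) : (halfQuantile c d u : ℝ) = (u / c) ^ (1 / d) := by
  have h : (u / c) ^ (1 / d) ≤ 1 / 2 := by
    calc (u / c) ^ (1 / d) ≤ ((1 / 2) ^ d) ^ (1 / d) := by
          refine Real.rpow_le_rpow (by positivity) ?_ (by positivity)
          rw [div_le_iff₀ hc, Real.div_rpow (by norm_num) (by norm_num), Real.one_rpow]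
          calc u ≤ _ := hu'
            _ = _ := by ring
      _ = 1 / 2 := by rw [← Real.rpow_mul (by norm_num), mul_one_div_cancel hd.ne', Real.rpow_one]
  simp only [halfQuantile, max_eq_left hu]
  rw [min_eq_right h, max_eq_right (by positivity)]

theorem halfQuantile_of_ge {c d u : ℝ} (hc : 0 < c) (hd : 0 < d) (hu : c / 2 ^ d ≤ u) :
    (halfQuantile c d u : ℝ) = 1 / 2 := by
  have hu0 : 0 ≤ u := le_trans (by positivity) hu
  have h : 1 / 2 ≤ (u / c) ^ (1 / d) := by
    calc (1 / 2 : ℝ) = ((1 / 2) ^ d) ^ (1 / d) := by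
          rw [← Real.rpow_mul (by norm_num), mul_one_div_cancel hd.ne', Real.rpow_one]
      _ ≤ (u / c) ^ (1 / d) := by
          refine Real.rpow_le_rpow (by positivity) ?_ (by positivity)
          rw [le_div_iff₀ hc, Real.div_rpow (by norm_num) (by norm_num), Real.one_rpow]
          calc _ = c / 2 ^ d := by ring
            _ ≤ u := hu
  simp only [halfQuantile, max_eq_left hu0]
  rw [min_eq_left h, max_eq_right (by norm_num)]

/-- The image has density `c d s^(d-1)` on `[0, 1/2]`, where `1 - s ≥ 1/2`; this choice of `c` makes
it fit under half of the tube density. Only half is available because `μ - ν₋` is only known to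
dominate `μ/2`. -/
theorem map_halfQuantile_le {c d K : ℝ} (hd : 1 ≤ d) (hK : 0 < K) (hc : c = K / (d * 2 ^ d)) :
    (volume.restrict (Ioc 0 (c / 2 ^ d))).map (halfQuantile c d) ≤
      (volume : Measure I).withDensity fun s =>
        2⁻¹ * ENNReal.ofReal (K * (s : ℝ) ^ (d - 1) * (1 - (s : ℝ)) ^ (d - 1)) := by
  have hd0 : 0 < d := by linarith
  have hc0 : 0 < c := by rw [hc]; positivity
  refine Measure.le_iff.2 fun A hA => ?_
  set S : Set ℝ := Subtype.val '' A ∩ Ioc 0 (1 / 2) with hS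
  have hAm : MeasurableSet (Subtype.val '' A) :=
    unitInterval.measurableEmbedding_coe.measurableSet_image.2 hA
  have hSm : MeasurableSet S := hAm.inter measurableSet_Ioc
  let F : ℝ → ℝ := fun s => c * s ^ d
  have hsub : halfQuantile c d ⁻¹' A ∩ Ioc 0 (c / 2 ^ d) ⊆ F '' S := by
    rintro u ⟨huA, hu0, hu1⟩
    have e := halfQuantile_of_mem hc0 hd0 hu0.le hu1
    have pos : 0 < (u / c) ^ (1 / d) := by positivity
    refine ⟨halfQuantile c d u, ⟨⟨_, huA, rfl⟩, by rw [e]; exact pos, ?_⟩, ?_⟩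
    · exact max_le (by norm_num) (min_le_left _ _)
    · simp only [F]
      rw [e, ← Real.rpow_mul (by positivity), one_div_mul_cancel hd0.ne', Real.rpow_one]
      field_simp
  have hderiv : ∀ x ∈ S, HasDerivWithinAt F (c * (d * x ^ (d - 1))) S x := fun x hx =>
    ((Real.hasDerivAt_rpow_const (Or.inr hd)).const_mul c).hasDerivWithinAt
  have hinj : InjOn F S := by
    intro x hx y hy hxy
    have : x ^ d = y ^ d := mul_left_cancel₀ hc0.ne' hxy
    exact (Real.rpow_left_inj hx.2.1.le hy.2.1.le hd0.ne').1 this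
  have key := lintegral_image_eq_lintegral_abs_deriv_mul hSm hderiv hinj 1
  simp only [Pi.one_apply, lintegral_const, one_mul, mul_one, Measure.restrict_apply_univ] at key
  rw [Measure.map_apply (by fun_prop) hA,
    Measure.restrict_apply (measurable_halfQuantile c d hA), withDensity_apply _ hA]
  refine (measure_mono hsub).trans ?_
  rw [key]
  rw [unitInterval.measurePreserving_coe.setLIntegral_comp_emb
    unitInterval.measurableEmbedding_coe
    (fun s : ℝ => 2⁻¹ * ENNReal.ofReal (K * s ^ (d - 1) * (1 - s) ^ (d - 1))),
    Measure.restrict_restrict hAm, inter_eq_left.2 (by rintro _ ⟨x, _, rfl⟩; exact x.2)]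
  refine le_trans (setLIntegral_mono' hSm fun s hs => ?_) (lintegral_mono_set inter_subset_left)
  have h2 : (2 : ℝ≥0∞)⁻¹ = ENNReal.ofReal (2⁻¹) := by
    rw [ENNReal.ofReal_inv_of_pos (by norm_num)]; norm_num
  rw [h2, ← ENNReal.ofReal_mul (by norm_num)]
  refine ENNReal.ofReal_le_ofReal ?_
  have hs0 := hs.2.1
  have hs1 := hs.2.2
  rw [abs_of_nonneg (by positivity)]
  have h : ((1 / 2 : ℝ)) ^ (d - 1) ≤ (1 - s) ^ (d - 1) :=
    Real.rpow_le_rpow (by norm_num) (by linarith) (by linarith)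
  have hpow : (2 : ℝ) ^ d = 2 * 2 ^ (d - 1) := by
    rw [Real.rpow_sub_one (by norm_num)]; ring
  calc c * (d * s ^ (d - 1)) = 2⁻¹ * (K * s ^ (d - 1) * (1 / 2) ^ (d - 1)) := by
        rw [hc, Real.div_rpow (by norm_num) (by norm_num), Real.one_rpow, hpow]
        field_simp
    _ ≤ 2⁻¹ * (K * s ^ (d - 1) * (1 - s) ^ (d - 1)) := by gcongr

theorem map_halfQuantile_prod_le {D : Type*} [MeasurableSpace D] (β : Measure D) [SFinite β]
    {c d K : ℝ} (hd : 1 ≤ d) (hK : 0 < K) (hc : c = K / (d * 2 ^ d)) :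
    ((volume.restrict (Ioc 0 (c / 2 ^ d))).map (halfQuantile c d)).prod β ≤
      (2⁻¹ : ℝ≥0∞) • tubeMeasure d K β := by
  refine (Measure.prod_mono (map_halfQuantile_le hd hK hc) le_rfl).trans_eq ?_
  rw [prod_withDensity_left (by fun_prop), tubeMeasure, ← withDensity_smul _ (by fun_prop)]
  rfl

/-- The cost of shifting the quantile function by `a`. -/
noncomputable def shiftCost (p c d a : ℝ) : ℝ≥0∞ :=
  ∫⁻ v in Ioc (-a) (c / 2 ^ d), edist (halfQuantile c d v) (halfQuantile c d (v + a)) ^ p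

theorem map_add_restrict (a M : ℝ) :
    (volume.restrict (Ioc (-a) M)).map (fun v => v + a) =
      (volume : Measure ℝ).restrict (Ioc 0 (M + a)) := by
  have := ((measurePreserving_add_right (volume : Measure ℝ) a).restrict_preimage
    (measurableSet_Ioc (a := 0) (b := M + a))).map_eq
  simpa using this

/-- The constant extension of the quantile turns the extra parameter interval of length `a` into an
atom at the left end; after the shift by `a`, the surplus interval lies on the right and gives the
atom at `1/2`. -/
theorem map_halfQuantile_shift_zero {c d a : ℝ} (hc : 0 < c) (hd : 0 < d) (ha : 0 ≤ a) :
    (volume.restrict (Ioc (-a) (c / 2 ^ d))).map (halfQuantile c d) =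
      (volume.restrict (Ioc 0 (c / 2 ^ d))).map (halfQuantile c d) +
        ENNReal.ofReal a • Measure.dirac 0 := by
  have hM : 0 ≤ c / 2 ^ d := by positivity
  rw [← Ioc_union_Ioc_eq_Ioc (neg_nonpos.2 ha) hM, Measure.restrict_union
    (Ioc_disjoint_Ioc_of_le le_rfl) measurableSet_Ioc, add_comm,
    Measure.map_add _ _ (by fun_prop)]
  congr 1
  have : (volume.restrict (Ioc (-a) 0)).map (halfQuantile c d) =
      (volume.restrict (Ioc (-a) 0)).map (fun _ => (0 : I)) := by
    refine Measure.map_congr ?_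
    filter_upwards [ae_restrict_mem measurableSet_Ioc] with u hu
    exact halfQuantile_of_nonpos hd hu.2
  rw [this, Measure.map_const]
  simp

theorem map_halfQuantile_shift_half {c d a : ℝ} (hc : 0 < c) (hd : 0 < d) (ha : 0 ≤ a) :
    (volume.restrict (Ioc (-a) (c / 2 ^ d))).map (fun v => halfQuantile c d (v + a)) =
      (volume.restrict (Ioc 0 (c / 2 ^ d))).map (halfQuantile c d) +
        ENNReal.ofReal a • Measure.dirac ⟨1 / 2, by norm_num, by norm_num⟩ := by
  have hM : 0 ≤ c / 2 ^ d := by positivity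
  have e : (fun v => halfQuantile c d (v + a)) = halfQuantile c d ∘ fun v => v + a := rfl
  rw [e, ← Measure.map_map (by fun_prop) (by fun_prop), map_add_restrict,
    ← Ioc_union_Ioc_eq_Ioc hM (le_add_of_nonneg_right ha), Measure.restrict_union
    (Ioc_disjoint_Ioc_of_le le_rfl) measurableSet_Ioc, Measure.map_add _ _ (by fun_prop)]
  congr 1
  have : (volume.restrict (Ioc (c / 2 ^ d) (c / 2 ^ d + a))).map (halfQuantile c d) =
      (volume.restrict (Ioc (c / 2 ^ d) (c / 2 ^ d + a))).map
        (fun _ => (⟨1 / 2, by norm_num, by norm_num⟩ : I)) := by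
    refine Measure.map_congr ?_
    filter_upwards [ae_restrict_mem measurableSet_Ioc] with u hu
    exact Subtype.ext (halfQuantile_of_ge hc hd hu.1.le)
  rw [this, Measure.map_const]
  simp

/-! ### Moving an atom along a bundle of curves -/

section Tube

variable {X : Type*} [PseudoEMetricSpace X] [MeasurableSpace X] [OpensMeasurableSpace X]
  [SecondCountableTopology X] {D : Type*} [MeasurableSpace D]

/-- An atom at the starting point of a bundle of curves can be spread over the midpoints. -/
theorem HasPlan.half_tube {p c d K a : ℝ} {L : ℝ≥0} (hp : 0 < p) (hd : 1 ≤ d) (hK : 0 < K)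
    (hc : c = K / (d * 2 ^ d)) (ha : 0 ≤ a) (β : Measure D) [IsFiniteMeasure β]
    {Φ : I × D → X} (hΦ : Measurable Φ) (hL : ∀ b : D, LipschitzWith L fun s : I => Φ (s, b))
    {y : X} (hy : ∀ b : D, Φ (0, b) = y) {μ : Measure X}
    (hμ : (2⁻¹ : ℝ≥0∞) • (tubeMeasure d K β).map Φ ≤ μ) [IsFiniteMeasure μ] :
    HasPlan p (μ + (ENNReal.ofReal a * β univ) • Measure.dirac y)
      (μ + ENNReal.ofReal a • β.map fun b => Φ (⟨1 / 2, by norm_num, by norm_num⟩, b))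
      (L ^ p * β univ * shiftCost p c d a) := by
  have hd0 : 0 < d := by linarith
  have hc0 : 0 < c := by rw [hc]; positivity
  set G := halfQuantile c d with hG
  have hGm : Measurable G := measurable_halfQuantile c d
  set ρ := (volume.restrict (Ioc 0 (c / 2 ^ d))).map G with hρ
  set τ : Measure ℝ := volume.restrict (Ioc (-a) (c / 2 ^ d)) with hτ
  set μ' := (ρ.prod β).map Φ with hμ'
  have hle : μ' ≤ μ := by
    refine le_trans ?_ hμ
    rw [← Measure.map_smul]
    exact Measure.map_mono (map_halfQuantile_prod_le β hd hK hc) hΦ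
  have : IsFiniteMeasure μ' := isFiniteMeasure_of_le μ hle
  have push (g : ℝ → I) (hg : Measurable g) :
      (τ.prod β).map (fun z => Φ (g z.1, z.2)) = ((τ.map g).prod β).map Φ := by
    have := Measure.map_prod_map τ β hg measurable_id
    rw [Measure.map_id] at this
    rw [this, Measure.map_map hΦ (by fun_prop)]
    rfl
  have atom (s : I) : ((ENNReal.ofReal a • Measure.dirac s).prod β).map Φ =
      ENNReal.ofReal a • β.map fun b => Φ (s, b) := by
    rw [Measure.prod_smul_left, Measure.map_smul, Measure.dirac_prod,
      Measure.map_map hΦ (by fun_prop)]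
    rfl
  have plan := HasPlan.of_map (p := p) (τ.prod β) (f := fun z => Φ (G z.1, z.2))
    (g := fun z => Φ (G (z.1 + a), z.2)) (by fun_prop) (by fun_prop)
  rw [push G hGm, push (fun v => G (v + a)) (by fun_prop),
    map_halfQuantile_shift_zero hc0 hd0 ha, map_halfQuantile_shift_half hc0 hd0 ha,
    Measure.add_prod, Measure.add_prod, Measure.map_add _ _ hΦ, Measure.map_add _ _ hΦ,
    atom, atom] at plan
  -- Only the part `μ'` carried by the first half of the bundle moves; the rest of `μ` stays in
  -- place.
  have plan' := (HasPlan.refl hp (μ - μ')).add plan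
  rw [← add_assoc, ← add_assoc, Measure.sub_add_cancel_of_le hle, zero_add] at plan'
  have e : (fun b => Φ (0, b)) = fun _ => y := funext hy
  rw [e, Measure.map_const, smul_smul] at plan'
  refine plan'.mono ?_
  calc ∫⁻ z, edist (Φ (G z.1, z.2)) (Φ (G (z.1 + a), z.2)) ^ p ∂τ.prod β
      ≤ ∫⁻ z, L ^ p * (fun v => edist (G v) (G (v + a)) ^ p) z.1 * (fun _ => 1) z.2 ∂τ.prod β := by
        refine lintegral_mono fun z => ?_
        simp only [mul_one]
        rw [← ENNReal.mul_rpow_of_nonneg _ _ hp.le]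
        exact ENNReal.rpow_le_rpow (hL z.2 _ _) hp.le
    _ = L ^ p * β univ * shiftCost p c d a := by
        simp_rw [mul_assoc]
        rw [lintegral_const_mul _ (by fun_prop),
          lintegral_prod_mul (f := fun v => edist (G v) (G (v + a)) ^ p) (g := fun _ => 1)
            (by fun_prop) (by fun_prop), shiftCost, lintegral_const, one_mul, mul_comm (β univ)]

theorem map_symm_tubeMeasure (d K : ℝ) (β : Measure D) [SFinite β] :
    (tubeMeasure d K β).map (fun z => (unitInterval.symm z.1, z.2)) = tubeMeasure d K β := by
  have hs : Measurable (unitInterval.symm) := unitInterval.measurable_symm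
  have hm : Measurable fun z : I × D => (unitInterval.symm z.1, z.2) := by fun_prop
  have hv : ((volume : Measure I).prod β).map (fun z => (unitInterval.symm z.1, z.2)) =
      (volume : Measure I).prod β := by
    have := Measure.map_prod_map (volume : Measure I) β hs measurable_id
    rw [Measure.map_id, unitInterval.measurePreserving_symm.map_eq] at this
    exact this.symm
  ext A hA
  rw [Measure.map_apply hm hA, tubeMeasure, withDensity_apply _ (hm hA), withDensity_apply _ hA]
  conv_rhs => rw [← hv, setLIntegral_map hA (by fun_prop) hm]
  refine lintegral_congr fun z => ?_
  simp only [unitInterval.coe_symm_eq, sub_sub_cancel]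
  congr 1
  ring

/-- An atom can be moved along a bundle of curves. -/
theorem HasPlan.tube [StandardBorelSpace X] [Nonempty X]
    {p c d K a : ℝ} {L : ℝ≥0} (hp : 1 ≤ p) (hd : 1 ≤ d) (hK : 0 < K)
    (hc : c = K / (d * 2 ^ d)) (ha : 0 ≤ a) (β : Measure D) [IsFiniteMeasure β]
    {Φ : I × D → X} (hΦ : Measurable Φ) (hL : ∀ b : D, LipschitzWith L fun s : I => Φ (s, b))
    {y y' : X} (hy : ∀ b : D, Φ (0, b) = y) (hy' : ∀ b : D, Φ (1, b) = y') {μ : Measure X}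
    (hμ : (2⁻¹ : ℝ≥0∞) • (tubeMeasure d K β).map Φ ≤ μ) [IsFiniteMeasure μ] :
    HasPlan p (μ + (ENNReal.ofReal a * β univ) • Measure.dirac y)
      (μ + (ENNReal.ofReal a * β univ) • Measure.dirac y')
      (2 ^ p * (L ^ p * β univ * shiftCost p c d a)) := by
  have hs : Measurable (unitInterval.symm) := unitInterval.measurable_symm
  have hm : Measurable fun z : I × D => (unitInterval.symm z.1, z.2) := by fun_prop
  have h₁ := HasPlan.half_tube (zero_lt_one.trans_le hp) hd hK hc ha β hΦ hL hy hμ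
  -- The reversed bundle starts at `y'` and has the same midpoints, so both half plans meet there.
  have h₂ := HasPlan.half_tube (Φ := fun z => Φ (unitInterval.symm z.1, z.2)) (y := y')
    (p := p) (L := L) (zero_lt_one.trans_le hp) hd hK hc ha β (by fun_prop)
    (fun b s t => by
      refine (hL b _ _).trans_eq ?_
      congr 1
      rw [edist_dist, edist_dist, Subtype.dist_eq, Subtype.dist_eq, Real.dist_eq, Real.dist_eq,
        unitInterval.coe_symm_eq, unitInterval.coe_symm_eq, sub_sub_sub_cancel_left, abs_sub_comm])
    (fun b => by simp [hy']) (μ := μ) (by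
      have e := Measure.map_map hΦ hm (μ := tubeMeasure d K β)
      rw [map_symm_tubeMeasure] at e
      rw [e] at hμ
      exact hμ)
  have hhalf : unitInterval.symm ⟨1 / 2, by norm_num, by norm_num⟩ =
      (⟨1 / 2, by norm_num, by norm_num⟩ : I) := by
    apply Subtype.ext; norm_num [unitInterval.coe_symm_eq]
  simp only [hhalf] at h₂
  have : IsFiniteMeasure (ENNReal.ofReal a •
      β.map fun b => Φ (⟨1 / 2, by norm_num, by norm_num⟩, b)) :=
    Measure.smul_finite _ ENNReal.ofReal_ne_top
  exact h₁.trans_same hp h₂.symm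

end Tube

/-! ### From atoms to arbitrary measures on the support -/

theorem MeasureTheory.SimpleFunc.map_measure_eq_sum {X : Type*} [MeasurableSpace X]
    (ξ : Measure X) (f : SimpleFunc X X) :
    ξ.map f = ∑ y ∈ f.range, ξ (f ⁻¹' {y}) • Measure.dirac y := by
  ext s hs
  have h := SimpleFunc.map_lintegral (μ := ξ) (s.indicator 1) f
  rw [← SimpleFunc.lintegral_eq_lintegral] at h
  have e : ∀ x, (f.map (s.indicator (1 : X → ℝ≥0∞))) x = (f ⁻¹' s).indicator 1 x := fun x => rfl
  simp only [e] at h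
  rw [lintegral_indicator_one (f.measurable hs)] at h
  rw [Measure.map_apply f.measurable hs, h]
  simp [Measure.dirac_apply' _ hs, mul_comm]

/-- The left side is a convex combination of the measures `μ + ξ univ • δ_x`. Mixing plans for
full-mass atoms keeps the bound `E`, independently of the number of atoms. -/
theorem HasPlan.map_simpleFunc {X : Type*} [PseudoEMetricSpace X] [MeasurableSpace X] {p : ℝ}
    {μ ξ : Measure X} {y : X} {E : ℝ≥0∞} (f : SimpleFunc X X)
    [IsFiniteMeasure ξ] (hξ : ξ ≠ 0)
    (h : ∀ x ∈ f.range, HasPlan p (μ + ξ univ • Measure.dirac x) (μ + ξ univ • Measure.dirac y) E) :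
    HasPlan p (μ + ξ.map f) (μ + ξ univ • Measure.dirac y) E := by
  have h0 : ξ univ ≠ 0 := by simpa using hξ
  have ht : ξ univ ≠ ∞ := measure_ne_top _ _
  let w : X → ℝ≥0∞ := fun x => ξ (f ⁻¹' {x}) / ξ univ
  have hw : ∑ x ∈ f.range, w x = 1 := by
    simp only [w, div_eq_mul_inv]
    rw [← Finset.sum_mul, SimpleFunc.sum_range_measure_preimage_singleton,
      ENNReal.mul_inv_cancel h0 ht]
  have key := HasPlan.sum f.range _ _ _ fun x hx => (h x hx).smul (w x)
  simp only [smul_add, Finset.sum_add_distrib, ← Finset.sum_smul, ← Finset.sum_mul, hw, one_smul,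
    one_mul, smul_smul] at key
  convert key using 2
  rw [SimpleFunc.map_measure_eq_sum]
  refine Finset.sum_congr rfl fun x _ => ?_
  simp only [w]
  rw [ENNReal.div_mul_cancel h0 ht]

section Diffuse

variable {X : Type*} [PseudoEMetricSpace X] [MeasurableSpace X] [OpensMeasurableSpace X]
  [SecondCountableTopology X] {p : ℝ}

/-- If single atoms of mass `m` placed in `S` can be moved to `y` in presence of `μ`, so can
any measure of mass `m` concentrated on `S`. -/
theorem HasPlan.of_atoms [StandardBorelSpace X] [Nonempty X] (hp : 1 ≤ p) {R : ℝ≥0∞}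
    (hR : R ≠ ∞) (hX : ∀ x y : X, edist x y ≤ R) {μ ξ : Measure X} [IsFiniteMeasure μ]
    [IsFiniteMeasure ξ] {S : Set X} (hS : ξ Sᶜ = 0) {y : X} {E : ℝ≥0∞} (hE : E ≠ 0) (hξ : ξ ≠ 0)
    (h : ∀ x ∈ S, HasPlan p (μ + ξ univ • Measure.dirac x) (μ + ξ univ • Measure.dirac y) E) :
    HasPlan p (μ + ξ) (μ + ξ univ • Measure.dirac y) (2 ^ p * E) := by
  have hp0 : 0 < p := by linarith
  obtain ⟨x₀, hx₀⟩ : S.Nonempty := by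
    rw [nonempty_iff_ne_empty]
    rintro rfl
    exact hξ (by simpa using hS)
  let f : ℕ → SimpleFunc X X := SimpleFunc.approxOn id measurable_id S x₀ hx₀
  have lim : Filter.Tendsto (fun n => ∫⁻ x, edist x (f n x) ^ p ∂ξ) Filter.atTop (nhds 0) := by
    have hae : ∀ᵐ x ∂ξ, x ∈ S := by rwa [ae_iff]
    have := tendsto_lintegral_of_dominated_convergence (μ := ξ)
      (F := fun n x => edist x (f n x) ^ p) (f := fun _ => 0) (fun _ => R ^ p)
      (fun n => by
        have := (f n).measurable
        fun_prop)
      (fun n => Filter.Eventually.of_forall fun x => ENNReal.rpow_le_rpow (hX _ _) hp0.le)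
      (by
        rw [lintegral_const]
        exact ENNReal.mul_ne_top (ENNReal.rpow_ne_top_of_nonneg hp0.le hR) (measure_ne_top _ _))
      (by
        filter_upwards [hae] with x hx
        have h₁ := SimpleFunc.tendsto_approxOn (measurable_id (α := X)) hx₀ (x := x)
          (subset_closure hx)
        have h₂ := ((tendsto_const_nhds (x := x)).edist h₁).ennrpow_const p
        simpa [hp0] using h₂)
    simpa using this
  -- Discretising costs less than `E`; this is why `E` must be nonzero.
  obtain ⟨n, hn⟩ := (lim.eventually_lt_const (pos_iff_ne_zero.2 hE)).exists
  have h₁ := HasPlan.of_map (p := p) ξ measurable_id (f n).measurable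
  rw [Measure.map_id] at h₁
  have h₂ := (HasPlan.refl hp0 μ).add (h₁.mono hn.le)
  rw [zero_add] at h₂
  refine h₂.trans_same hp (HasPlan.map_simpleFunc (f n) hξ fun x hx => ?_)
  obtain ⟨z, rfl⟩ := SimpleFunc.mem_range.1 hx
  exact h _ (SimpleFunc.approxOn_mem _ _ _ _)

/-- In presence of half of a strongly connected measure, atoms can be moved across its support
at the cost of shifts of the quantile function. -/
theorem IsStronglyConnectedMeasure.exists_hasPlan_atoms [StandardBorelSpace X] [Nonempty X]
    {d : ℝ} (hp : 1 ≤ p) (hd : 1 ≤ d) {μ : Measure X} (hμ : IsStronglyConnectedMeasure d μ) :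
    ∃ c r : ℝ, ∃ A : ℝ≥0∞, 0 < c ∧ 0 < r ∧ A ≠ ∞ ∧
      ∀ μ' : Measure X, IsFiniteMeasure μ' → (2⁻¹ : ℝ≥0∞) • μ ≤ μ' → ∀ m : ℝ≥0∞, m ≠ ∞ →
        ∀ x ∈ μ.support, ∀ y ∈ μ.support,
          HasPlan p (μ' + m • Measure.dirac x) (μ' + m • Measure.dirac y)
            (A * shiftCost p c d (r * m.toReal)) := by
  obtain ⟨L, K, N, D, _, β, -, hK, -, _, hβ, H⟩ := hμ
  have hβ0 : β univ ≠ 0 := by simpa using hβ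
  have hβt : β univ ≠ ∞ := measure_ne_top _ _
  have hβr : 0 < (β univ).toReal := ENNReal.toReal_pos hβ0 hβt
  have hd0 : 0 < d := by linarith
  refine ⟨K / (d * 2 ^ d), (β univ).toReal⁻¹, (2 ^ p) ^ N * (2 ^ p * (L ^ p * β univ)),
    by positivity, by positivity, by finiteness, ?_⟩
  intro μ' _ hμ' m hm x hx y hy
  obtain ⟨n, z, Φ, hn, rfl, rfl, -, hΦ⟩ := H x hx y hy
  set a := (β univ).toReal⁻¹ * m.toReal
  have ha : 0 ≤ a := by positivity
  have e : ENNReal.ofReal a * β univ = m := by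
    simp only [a]
    rw [ENNReal.ofReal_mul (by positivity), ENNReal.ofReal_toReal hm,
      ENNReal.ofReal_inv_of_pos hβr, ENNReal.ofReal_toReal hβt, mul_right_comm,
      ENNReal.inv_mul_cancel hβ0 hβt, one_mul]
  have fin : ∀ i, IsFiniteMeasure (μ' + m • Measure.dirac (z i)) := fun i => by
    have := Measure.smul_finite (Measure.dirac (z i)) hm
    infer_instance
  have key := HasPlan.chain (p := p) hp (fun i => μ' + m • Measure.dirac (z i)) fun j => by
    obtain ⟨h₁, -, h₂, -, h₃, h₄, h₅⟩ := hΦ j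
    have := HasPlan.tube (p := p) hp hd hK rfl ha β h₁ h₂ h₃ h₄ (μ := μ')
      (le_trans (by gcongr) hμ')
    rwa [e] at this
  refine key.mono ?_
  calc (2 ^ p) ^ n * (2 ^ p * (L ^ p * β univ * shiftCost p (K / (d * 2 ^ d)) d a))
      ≤ (2 ^ p) ^ N * (2 ^ p * (L ^ p * β univ * shiftCost p (K / (d * 2 ^ d)) d a)) := by
        gcongr
        · exact ENNReal.one_le_two_rpow hp
        · omega
    _ = _ := by ring

end Diffuse

/-! ### Reduction of the signed perturbation to transport of its two parts -/

section Signed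

variable {X : Type*} [MeasurableSpace X]

theorem posPart_univ_eq_negPart_univ {ν : SignedMeasure X} (hν : ν univ = 0) :
    ν.toJordanDecomposition.posPart univ = ν.toJordanDecomposition.negPart univ := by
  have h := ν.toSignedMeasure_toJordanDecomposition
  rw [← h, JordanDecomposition.toSignedMeasure,
    Measure.toSignedMeasure_sub_apply MeasurableSet.univ, sub_eq_zero] at hν
  exact (measureReal_eq_measureReal_iff).1 hν

theorem tvNorm_eq {ν : SignedMeasure X} (hν : ν univ = 0) :
    tvNorm ν = 2 * (ν.toJordanDecomposition.negPart univ).toReal := by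
  rw [tvNorm, SignedMeasure.totalVariation, measureReal_def, Measure.add_apply,
    posPart_univ_eq_negPart_univ hν, ENNReal.toReal_add (measure_ne_top _ _) (measure_ne_top _ _)]
  ring

theorem add_negPart_eq {ν : SignedMeasure X} {μ η : Measure X} [IsFiniteMeasure μ]
    [IsFiniteMeasure η] (h : η.toSignedMeasure = μ.toSignedMeasure + ν) :
    η + ν.toJordanDecomposition.negPart = μ + ν.toJordanDecomposition.posPart := by
  rw [← Measure.toSignedMeasure_eq_toSignedMeasure_iff, Measure.toSignedMeasure_add,
    Measure.toSignedMeasure_add, h]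
  nth_rw 1 [← ν.toSignedMeasure_toJordanDecomposition]
  rw [JordanDecomposition.toSignedMeasure]
  abel

end Signed

/-- The transport bound in terms of the one-dimensional cost. -/
theorem IsStronglyConnectedMeasure.exists_wassersteinDist_le {X : Type*} [PseudoEMetricSpace X]
    [MeasurableSpace X] [OpensMeasurableSpace X] [SecondCountableTopology X]
    [StandardBorelSpace X] {R : ℝ≥0∞} (hR : R ≠ ∞) (hX : ∀ x y : X, edist x y ≤ R)
    {p d : ℝ} (hp : 1 ≤ p) (hd : 1 ≤ d)
    {μ : Measure X} [IsProbabilityMeasure μ] (hμ : IsStronglyConnectedMeasure d μ) :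
    ∃ c r : ℝ, ∃ A : ℝ≥0∞, 0 < c ∧ 0 < r ∧ A ≠ ∞ ∧
      ∀ (ν : SignedMeasure X) (η : Measure X) [IsFiniteMeasure η],
        η.toSignedMeasure = μ.toSignedMeasure + ν →
        ν univ = 0 →
        ν.totalVariation.support ⊆ μ.support →
        ν.toJordanDecomposition.negPart ≤ (2⁻¹ : ℝ≥0∞) • μ →
        0 ≤ tvNorm ν ∧ tvNorm ν ≤ 1 ∧ (tvNorm ν = 0 → wassersteinDist p η μ = 0) ∧
        ∀ E : ℝ≥0∞, E ≠ 0 → shiftCost p c d (r * tvNorm ν) ≤ E →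
          wassersteinDist p η μ ≤ (A * E) ^ (1 / p) := by
  have : Nonempty X := nonempty_of_isProbabilityMeasure μ
  have hp0 : 0 < p := by linarith
  obtain ⟨c, r, A, hc, hr, hA, H⟩ := hμ.exists_hasPlan_atoms hp hd
  -- `tvNorm ν` is twice the mass to be moved, hence `r / 2`. Replacing `A` by `A + 1` keeps the
  -- bound for atoms nonzero.
  refine ⟨c, r / 2, 2 ^ p * (2 ^ p * (A + 1)), hc, by positivity, by finiteness, ?_⟩
  intro ν η _ hη hν hsupp hneg
  set P := ν.toJordanDecomposition.posPart with hP
  set Q := ν.toJordanDecomposition.negPart with hQ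
  have hPQ : P univ = Q univ := posPart_univ_eq_negPart_univ hν
  have htv : tvNorm ν = 2 * (Q univ).toReal := tvNorm_eq hν
  have hQle : Q ≤ μ := hneg.trans (by
    intro s
    rw [Measure.smul_apply, smul_eq_mul]
    exact mul_le_of_le_one_left' (by norm_num))
  have hadd : η + Q = μ + P := add_negPart_eq hη
  have hμQ : μ - Q + Q = μ := Measure.sub_add_cancel_of_le hQle
  have hηP : η = μ - Q + P := by
    refine (Measure.add_left_inj Q _ _).1 ?_
    rw [hadd, add_right_comm, hμQ]
  have hhalf : (2⁻¹ : ℝ≥0∞) • μ ≤ μ - Q := by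
    refine Measure.le_iff.2 fun s hs => ?_
    rw [Measure.sub_apply hs hQle, Measure.smul_apply, smul_eq_mul]
    refine ENNReal.le_sub_of_add_le_right (measure_ne_top _ _) ?_
    have h := hneg s
    rw [Measure.smul_apply, smul_eq_mul] at h
    calc 2⁻¹ * μ s + Q s ≤ 2⁻¹ * μ s + 2⁻¹ * μ s := by gcongr
      _ = μ s := by rw [← add_mul, ENNReal.inv_two_add_inv_two, one_mul]
  have hPs : P μ.supportᶜ = 0 := by
    refine measure_mono_null (compl_subset_compl.2 hsupp) ?_
    have h : ν.totalVariation ν.totalVariation.supportᶜ = 0 := Measure.measure_compl_support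
    rw [SignedMeasure.totalVariation, Measure.add_apply, add_eq_zero] at h
    exact h.1
  have hQs : Q μ.supportᶜ = 0 := by
    have h := hneg μ.supportᶜ
    rw [Measure.smul_apply, Measure.measure_compl_support, smul_zero] at h
    exact nonpos_iff_eq_zero.1 h
  have hQ1 : Q univ ≤ 2⁻¹ := by simpa using hneg univ
  refine ⟨by rw [htv]; positivity, ?_, fun h0 => ?_, fun E hE hcost => ?_⟩
  · rw [htv]
    have := ENNReal.toReal_mono (by norm_num) hQ1
    norm_num at this
    linarith
  · have hQ0 : Q = 0 := by
      rw [htv] at h0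
      have : (Q univ).toReal = 0 := by linarith
      simpa [ENNReal.toReal_eq_zero_iff] using this
    have hP0 : P = 0 := by simpa [hQ0] using hPQ
    have : η = μ := by simpa [hQ0, hP0] using hadd
    rw [this]
    have := (HasPlan.refl hp0 μ).wassersteinDist_le hp0
    simpa [hp0] using this
  · obtain ⟨y, hy⟩ : μ.support.Nonempty := Measure.nonempty_support (NeZero.ne μ)
    by_cases hQ0 : Q = 0
    · have hP0 : P = 0 := by simpa [hQ0] using hPQ
      have : η = μ := by simpa [hQ0, hP0] using hadd
      rw [this]
      exact ((HasPlan.refl hp0 μ).mono zero_le).wassersteinDist_le hp0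
    have hP0 : P ≠ 0 := by
      intro h
      rw [h] at hPQ
      exact hQ0 (by simpa using hPQ.symm)
    have hcost' : A * shiftCost p c d (r * (Q univ).toReal) ≤ (A + 1) * E := by
      rw [htv, show r / 2 * (2 * (Q univ).toReal) = r * (Q univ).toReal by ring] at hcost
      exact mul_le_mul' le_self_add hcost
    have hE' : (A + 1) * E ≠ 0 := mul_ne_zero (by simp) hE
    have atoms := fun x hx => (H (μ - Q) inferInstance hhalf (Q univ) (measure_ne_top _ _) x hx
      y hy).mono hcost'
    have h₁ := HasPlan.of_atoms hp hR hX hPs hE' hP0 (y := y) (μ := μ - Q) (by rwa [hPQ])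
    have h₂ := HasPlan.of_atoms hp hR hX hQs hE' hQ0 (y := y) (μ := μ - Q) atoms
    rw [hPQ, ← hηP] at h₁
    rw [hμQ] at h₂
    have := Measure.smul_finite (Measure.dirac y) (measure_ne_top Q univ)
    refine ((h₁.trans_same hp h₂.symm).wassersteinDist_le hp0).trans_eq ?_
    congr 1
    ring

/-! ### Estimates of the shift cost -/

theorem edist_halfQuantile_le {c d u v : ℝ} (hc : 0 < c) (hd : 0 < d) (huv : u ≤ v) :
    edist (halfQuantile c d u) (halfQuantile c d v) ≤
      ENNReal.ofReal ((max v 0 / c) ^ (1 / d) - (max u 0 / c) ^ (1 / d)) := by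
  have h : (max u 0 / c) ^ (1 / d) ≤ (max v 0 / c) ^ (1 / d) := by gcongr
  rw [edist_comm, edist_dist, Subtype.dist_eq, Real.dist_eq]
  refine ENNReal.ofReal_le_ofReal ?_
  simp only [halfQuantile]
  generalize (max u 0 / c) ^ (1 / d) = x at *
  generalize (max v 0 / c) ^ (1 / d) = y at *
  rw [abs_le]
  simp only [max_def, min_def]
  constructor <;> split_ifs <;> linarith

theorem rpow_add_sub_rpow_le {v a q : ℝ} (hv : 0 < v) (ha : 0 ≤ a) (hq : q ≤ 1) :
    (v + a) ^ q - v ^ q ≤ a * v ^ (q - 1) := by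
  have h : 1 ≤ 1 + a / v := by
    have : 0 ≤ a / v := by positivity
    linarith
  have e : v + a = v * (1 + a / v) := by field_simp
  rw [e, Real.mul_rpow hv.le (by linarith), Real.rpow_sub_one hv.ne']
  have := Real.rpow_le_rpow_of_exponent_le h hq
  rw [Real.rpow_one] at this
  calc v ^ q * (1 + a / v) ^ q - v ^ q ≤ v ^ q * (1 + a / v) - v ^ q := by gcongr
    _ = a * (v ^ q / v) := by ring

/-- For `v ≤ a` the displacement is at most the quantile `(2a/c)^(1/d)`; for `v > a` it is
controlled by the Bernoulli-type bound `rpow_add_sub_rpow_le`. -/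
theorem shiftCost_le {p c d a : ℝ} (hp : 1 ≤ p) (hd : 1 ≤ d) (hc : 0 < c) (ha : 0 < a) :
    shiftCost p c d a ≤ ENNReal.ofReal (2 * (2 / c) ^ (p / d) * a ^ (p / d + 1)) +
      ENNReal.ofReal (c⁻¹ ^ (p / d) * a ^ p) *
        ∫⁻ v in Ioc a (c / 2 ^ d), ENNReal.ofReal (v ^ (p / d - p)) := by
  have hp0 : 0 < p := by linarith
  have hd0 : 0 < d := by linarith
  have hpd : 1 / d * p = p / d := by ring
  set f : ℝ → ℝ≥0∞ := fun v => edist (halfQuantile c d v) (halfQuantile c d (v + a)) ^ p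
  have near : ∫⁻ v in Ioc (-a) a, f v ≤
      ENNReal.ofReal (2 * (2 / c) ^ (p / d) * a ^ (p / d + 1)) := by
    calc ∫⁻ v in Ioc (-a) a, f v
        ≤ ∫⁻ v in Ioc (-a) a, ENNReal.ofReal ((2 * a / c) ^ (p / d)) := by
          refine setLIntegral_mono' measurableSet_Ioc fun v hv => ?_
          rw [← hpd, Real.rpow_mul (by positivity), ← ENNReal.ofReal_rpow_of_nonneg (by positivity)
            hp0.le]
          refine ENNReal.rpow_le_rpow ((edist_halfQuantile_le hc hd0 (by linarith)).trans
            (ENNReal.ofReal_le_ofReal ?_)) hp0.le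
          have h₁ : 0 ≤ (max v 0 / c) ^ (1 / d) := by positivity
          have h₂ : (max (v + a) 0 / c) ^ (1 / d) ≤ (2 * a / c) ^ (1 / d) := by
            have : max (v + a) 0 ≤ 2 * a := max_le (by linarith [hv.2]) (by positivity)
            gcongr
          linarith
      _ = _ := by
          rw [setLIntegral_const, Real.volume_Ioc, ← ENNReal.ofReal_mul (by positivity)]
          congr 1
          rw [show 2 * a / c = 2 / c * a by ring, Real.mul_rpow (by positivity) ha.le,
            Real.rpow_add_one ha.ne']
          ring
  have far : ∫⁻ v in Ioc a (c / 2 ^ d), f v ≤ ENNReal.ofReal (c⁻¹ ^ (p / d) * a ^ p) *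
        ∫⁻ v in Ioc a (c / 2 ^ d), ENNReal.ofReal (v ^ (p / d - p)) := by
    rw [← lintegral_const_mul _ (by fun_prop)]
    refine setLIntegral_mono' measurableSet_Ioc fun v hv => ?_
    have hv0 : 0 < v := ha.trans hv.1
    rw [← ENNReal.ofReal_mul (by positivity)]
    have e : c⁻¹ ^ (p / d) * a ^ p * v ^ (p / d - p) =
        (c⁻¹ ^ (1 / d) * (a * v ^ (1 / d - 1))) ^ p := by
      rw [Real.mul_rpow (by positivity) (by positivity), Real.mul_rpow ha.le (by positivity),
        ← Real.rpow_mul (by positivity), ← Real.rpow_mul hv0.le, sub_mul, hpd, one_mul, mul_assoc]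
    rw [e, ← ENNReal.ofReal_rpow_of_nonneg (by positivity) hp0.le]
    refine ENNReal.rpow_le_rpow ((edist_halfQuantile_le hc hd0 (by linarith)).trans
      (ENNReal.ofReal_le_ofReal ?_)) hp0.le
    rw [max_eq_left (by linarith), max_eq_left hv0.le, div_eq_inv_mul _ c, div_eq_inv_mul _ c,
      Real.mul_rpow (by positivity) (by positivity), Real.mul_rpow (by positivity) hv0.le, ← mul_sub]
    gcongr
    exact rpow_add_sub_rpow_le hv0 ha.le ((div_le_one hd0).2 hd)
  -- Only an inclusion, since `a` may exceed `c / 2 ^ d`.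
  have hsub : Ioc (-a) (c / 2 ^ d) ⊆ Ioc (-a) a ∪ Ioc a (c / 2 ^ d) := by
    intro v hv
    rcases le_or_gt v a with h | h
    · exact Or.inl ⟨hv.1, h⟩
    · exact Or.inr ⟨h, hv.2⟩
  exact (lintegral_mono_set hsub).trans ((lintegral_union_le _ _ _).trans (add_le_add near far))

theorem lintegral_Ioc_rpow_le {a M e B : ℝ} (ha : 0 < a)
    (h : a ≤ M → ∫ v in a..M, v ^ e ≤ B) :
    ∫⁻ v in Ioc a M, ENNReal.ofReal (v ^ e) ≤ ENNReal.ofReal B := by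
  rcases le_or_gt a M with hM | hM
  · have hint : IntervalIntegrable (fun v : ℝ => v ^ e) volume a M :=
      intervalIntegral.intervalIntegrable_rpow (Or.inr (notMem_uIcc_of_lt ha (ha.trans_le hM)))
    rw [← ofReal_integral_eq_lintegral_ofReal ((intervalIntegrable_iff_integrableOn_Ioc_of_le hM).1
      hint), ← intervalIntegral.integral_of_le hM]
    · exact ENNReal.ofReal_le_ofReal (h hM)
    · filter_upwards [ae_restrict_mem measurableSet_Ioc] with v hv
      have : 0 < v := ha.trans hv.1
      positivity
  · simp [Ioc_eq_empty_of_le hM.le]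

theorem shiftCost_le_of_tail {p c d a B : ℝ} (hp : 1 ≤ p) (hd : 1 ≤ d) (hc : 0 < c) (ha : 0 < a)
    (hB : 0 ≤ B) (h : a ≤ c / 2 ^ d → ∫ v in a..(c / 2 ^ d), v ^ (p / d - p) ≤ B) :
    shiftCost p c d a ≤
      ENNReal.ofReal (2 * (2 / c) ^ (p / d) * a ^ (p / d + 1) + c⁻¹ ^ (p / d) * a ^ p * B) := by
  rw [ENNReal.ofReal_add (by positivity) (by positivity), ENNReal.ofReal_mul (q := B)
    (by positivity)]
  refine (shiftCost_le hp hd hc ha).trans ?_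
  gcongr
  exact lintegral_Ioc_rpow_le ha h

/-- If `1/d + 1/p < 1`, the tail integral is dominated by its lower limit and both contributions
scale as `t^(p/d+1)`. Otherwise it is bounded, and `t ≤ 1` lets `t^p` absorb the near part. -/
theorem exists_shiftCost_le_rpow {p c d r : ℝ} (hp : 1 < p) (hd : 1 ≤ d) (hc : 0 < c)
    (hr : 0 < r) (hne : 1 / d + 1 / p ≠ 1) :
    ∃ C : ℝ, 0 < C ∧ ∀ t : ℝ, 0 < t → t ≤ 1 →
      shiftCost p c d (r * t) ≤ ENNReal.ofReal (C * (t ^ min 1 (1 / d + 1 / p)) ^ p) := by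
  have hp0 : 0 < p := by linarith
  have hd0 : 0 < d := by linarith
  have hsum : (1 / d + 1 / p) * p = p / d + 1 := by field_simp
  set M := c / 2 ^ d with hM
  have hM0 : 0 < M := by positivity
  rcases lt_or_gt_of_ne hne with hlt | hgt
  · have he : p / d - p + 1 < 0 := by
      have := mul_lt_mul_of_pos_right hlt hp0
      rw [hsum, one_mul] at this
      linarith
    set s := -(p / d - p + 1) with hs
    have hs0 : 0 < s := by linarith
    refine ⟨2 * (2 / c) ^ (p / d) * r ^ (p / d + 1) +
      c⁻¹ ^ (p / d) * r ^ (p / d + 1) / s, by positivity, fun t ht ht1 => ?_⟩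
    have hrt : 0 < r * t := by positivity
    refine (shiftCost_le_of_tail (B := (r * t) ^ (p / d - p + 1) / s) hp.le hd hc hrt
      (by positivity) fun hle => ?_).trans (ENNReal.ofReal_le_ofReal (le_of_eq ?_))
    · rw [integral_rpow (Or.inr ⟨by linarith, notMem_uIcc_of_lt hrt hM0⟩)]
      have : 0 ≤ (c / 2 ^ d) ^ (p / d - p + 1) := by positivity
      rw [← neg_div_neg_eq]
      gcongr
      linarith
    · rw [min_eq_right hlt.le, ← Real.rpow_mul ht.le, hsum, Real.mul_rpow hr.le ht.le]
      have e : (r * t) ^ p * (r * t) ^ (p / d - p + 1) = r ^ (p / d + 1) * t ^ (p / d + 1) := by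
        rw [← Real.rpow_add hrt, ← Real.mul_rpow hr.le ht.le]
        congr 1; ring
      linear_combination c⁻¹ ^ (p / d) / s * e
  · have he : 0 < p / d - p + 1 := by
      have := mul_lt_mul_of_pos_right hgt hp0
      rw [hsum, one_mul] at this
      linarith
    set s := p / d - p + 1 with hs
    refine ⟨2 * (2 / c) ^ (p / d) * r ^ (p / d + 1) +
      c⁻¹ ^ (p / d) * r ^ p * (M ^ s / s), by positivity, fun t ht ht1 => ?_⟩
    have hrt : 0 < r * t := by positivity
    refine (shiftCost_le_of_tail (B := M ^ s / s) hp.le hd hc hrt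
      (by positivity) fun hle => ?_).trans (ENNReal.ofReal_le_ofReal ?_)
    · rw [integral_rpow (Or.inl (by linarith))]
      have : 0 ≤ (r * t) ^ (p / d - p + 1) := by positivity
      gcongr
      linarith
    · rw [min_eq_left hgt.le, Real.rpow_one, Real.mul_rpow hr.le ht.le, Real.mul_rpow hr.le ht.le]
      have : t ^ (p / d + 1) ≤ t ^ p := Real.rpow_le_rpow_of_exponent_ge ht ht1 (by linarith)
      calc 2 * (2 / c) ^ (p / d) * (r ^ (p / d + 1) * t ^ (p / d + 1)) +
            c⁻¹ ^ (p / d) * (r ^ p * t ^ p) * (M ^ s / s)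
          ≤ 2 * (2 / c) ^ (p / d) * (r ^ (p / d + 1) * t ^ p) +
            c⁻¹ ^ (p / d) * (r ^ p * t ^ p) * (M ^ s / s) := by gcongr
        _ = _ := by ring

theorem exists_shiftCost_le_log {p c d r : ℝ} (hp : 1 < p) (hd : 1 ≤ d) (hc : 0 < c)
    (hr : 0 < r) (heq : 1 / d + 1 / p = 1) :
    ∃ C : ℝ, 0 < C ∧ ∀ t : ℝ, 0 < t → t ≤ 1 →
      shiftCost p c d (r * t) ≤ ENNReal.ofReal (C * (t * Real.log (t⁻¹ + 1)) ^ p) := by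
  have hp0 : 0 < p := by linarith
  have hd0 : 0 < d := by linarith
  have hsum : (1 / d + 1 / p) * p = p / d + 1 := by field_simp
  rw [heq, one_mul] at hsum
  set M := c / 2 ^ d with hM
  have hM0 : 0 < M := by positivity
  have hlog2 : 0 < Real.log 2 := Real.log_pos (by norm_num)
  set C₁ := 2 * (2 / c) ^ (p / d) * r ^ p
  set C₂ := c⁻¹ ^ (p / d) * r ^ p
  set B₀ := |Real.log (M / r)|
  have hC₁ : 0 < C₁ := by positivity
  have hC₂ : 0 < C₂ := by positivity
  refine ⟨((C₁ + C₂ * B₀) / Real.log 2 + C₂) * Real.log 2 ^ (1 - p), by positivity,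
    fun t ht ht1 => ?_⟩
  have hrt : 0 < r * t := by positivity
  set ℓ := Real.log (t⁻¹ + 1) with hℓ
  have htinv : 1 ≤ t⁻¹ := (one_le_inv₀ ht).2 ht1
  have hℓ2 : Real.log 2 ≤ ℓ := Real.log_le_log (by norm_num) (by linarith)
  have hℓ0 : 0 < ℓ := hlog2.trans_le hℓ2
  refine (shiftCost_le_of_tail (B := B₀ + ℓ) hp.le hd hc hrt (by positivity)
    fun hle => ?_).trans (ENNReal.ofReal_le_ofReal ?_)
  · have e : p / d - p = -1 := by linarith
    simp only [e, Real.rpow_neg_one]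
    rw [integral_inv_of_pos hrt hM0, show M / (r * t) = M / r * t⁻¹ by field_simp,
      Real.log_mul (by positivity) (by positivity)]
    exact add_le_add (le_abs_self _) (Real.log_le_log (inv_pos.2 ht) (by linarith))
  · rw [← hsum, Real.mul_rpow hr.le ht.le, Real.mul_rpow ht.le hℓ0.le]
    have h₁ : 1 ≤ ℓ / Real.log 2 := (one_le_div hlog2).2 hℓ2
    -- The integral yields only one factor `ℓ`; weakening it to `ℓ ^ p`, possible as `ℓ ≥ log 2`,
    -- gives the stated form after the `p`-th root.
    have h₂ : ℓ ≤ Real.log 2 ^ (1 - p) * ℓ ^ p := by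
      calc ℓ = ℓ ^ (1 - p) * ℓ ^ p := by
            rw [← Real.rpow_add hℓ0, sub_add_cancel, Real.rpow_one]
        _ ≤ _ := by
            gcongr ?_ * _
            exact Real.rpow_le_rpow_of_nonpos hlog2 hℓ2 (sub_nonpos.2 hp.le)
    have hCB : 0 ≤ C₁ + C₂ * B₀ := by positivity
    calc 2 * (2 / c) ^ (p / d) * (r ^ p * t ^ p) + c⁻¹ ^ (p / d) * (r ^ p * t ^ p) * (B₀ + ℓ)
        = t ^ p * ((C₁ + C₂ * B₀) * 1 + C₂ * ℓ) := by simp only [C₁, C₂]; ring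
      _ ≤ t ^ p * ((C₁ + C₂ * B₀) * (ℓ / Real.log 2) + C₂ * ℓ) := by gcongr
      _ = t ^ p * (((C₁ + C₂ * B₀) / Real.log 2 + C₂) * ℓ) := by ring
      _ ≤ t ^ p * (((C₁ + C₂ * B₀) / Real.log 2 + C₂) * (Real.log 2 ^ (1 - p) * ℓ ^ p)) := by
          gcongr
      _ = _ := by ring

/-! ### Passage to the Wasserstein distance and conclusion -/

theorem rpow_mul_ofReal_le {A : ℝ≥0∞} (hA : A ≠ ∞) {C x p : ℝ} (hC : 0 ≤ C) (hx : 0 ≤ x)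
    (hp : 0 < p) : (A * ENNReal.ofReal (C * x ^ p)) ^ (1 / p) ≤
      ENNReal.ofReal (((A.toReal * C) ^ (1 / p) + 1) * x) := by
  have hA0 : 0 ≤ A.toReal := ENNReal.toReal_nonneg
  rw [← ENNReal.ofReal_toReal hA, ← ENNReal.ofReal_mul hA0,
    ENNReal.ofReal_rpow_of_nonneg (by positivity) (by positivity), ENNReal.toReal_ofReal hA0,
    ← mul_assoc, Real.mul_rpow (by positivity) (by positivity), ← Real.rpow_mul hx,
    mul_one_div_cancel hp.ne', Real.rpow_one]
  refine ENNReal.ofReal_le_ofReal ?_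
  gcongr
  linarith

/-- A bound of the one-dimensional cost by `C (g t) ^ p` yields a bound of the Wasserstein
distance by a multiple of `g ‖ν‖_TV`. -/
theorem IsStronglyConnectedMeasure.exists_wassersteinDist_le_of_shiftCost {X : Type*}
    [PseudoEMetricSpace X] [MeasurableSpace X] [OpensMeasurableSpace X]
    [SecondCountableTopology X] [StandardBorelSpace X] {R : ℝ≥0∞} (hR : R ≠ ∞)
    (hX : ∀ x y : X, edist x y ≤ R) {p d : ℝ} (hp : 1 ≤ p) (hd : 1 ≤ d)
    {μ : Measure X} [IsProbabilityMeasure μ] (hμ : IsStronglyConnectedMeasure d μ)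
    (g : ℝ → ℝ) (hg : ∀ t, 0 < t → 0 < g t)
    (hcost : ∀ c r : ℝ, 0 < c → 0 < r → ∃ C : ℝ, 0 < C ∧ ∀ t : ℝ, 0 < t → t ≤ 1 →
      shiftCost p c d (r * t) ≤ ENNReal.ofReal (C * g t ^ p)) :
    ∃ C : ℝ, 0 < C ∧
      ∀ (ν : SignedMeasure X) (η : Measure X) [IsFiniteMeasure η],
        η.toSignedMeasure = μ.toSignedMeasure + ν →
        ν univ = 0 →
        ν.totalVariation.support ⊆ μ.support →
        ν.toJordanDecomposition.negPart ≤ (2⁻¹ : ℝ≥0∞) • μ →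
        wassersteinDist p η μ ≤ ENNReal.ofReal (C * g (tvNorm ν)) := by
  have hp0 : 0 < p := by linarith
  obtain ⟨c, r, A, hc, hr, hA, H⟩ := hμ.exists_wassersteinDist_le hR hX hp hd
  obtain ⟨C, hC, hcost⟩ := hcost c r hc hr
  -- The summand `1` makes the constant positive even if `A = 0`.
  refine ⟨(A.toReal * C) ^ (1 / p) + 1, by positivity, fun ν η _ h₁ h₂ h₃ h₄ => ?_⟩
  obtain ⟨hnn, hle, hzero, hE⟩ := H ν η h₁ h₂ h₃ h₄
  rcases hnn.eq_or_lt with h0 | hpos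
  · rw [hzero h0.symm]
    exact zero_le
  · have hgpos := hg _ hpos
    refine (hE _ ?_ (hcost _ hpos hle)).trans (rpow_mul_ofReal_le hA hC.le hgpos.le hp0)
    rw [ne_eq, ENNReal.ofReal_eq_zero, not_le]
    positivity

theorem mainTheorem5 (k : ℕ) (Ω : Set (EuclideanSpace ℝ (Fin k)))
    (hΩ : IsCompact Ω) (hΩ' : closure (interior Ω) = Ω)
    (p d : ℝ) (hp : 1 < p) (hd : 1 ≤ d)
    (μ : Measure Ω) [IsProbabilityMeasure μ] (hμ : IsStronglyConnectedMeasure d μ) :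
    (1 / d + 1 / p ≠ 1 →
      ∃ C : ℝ, 0 < C ∧
        ∀ (ν : SignedMeasure Ω) (η : Measure Ω) [IsFiniteMeasure η],
          η.toSignedMeasure = μ.toSignedMeasure + ν →
          ν univ = 0 →
          ν.totalVariation.support ⊆ μ.support →
          ν.toJordanDecomposition.negPart ≤ (2⁻¹ : ℝ≥0∞) • μ →
          wassersteinDist p η μ ≤ ENNReal.ofReal (C * tvNorm ν ^ min 1 (1 / d + 1 / p))) ∧
    (1 / d + 1 / p = 1 →
      ∃ C : ℝ, 0 < C ∧
        ∀ (ν : SignedMeasure Ω) (η : Measure Ω) [IsFiniteMeasure η],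
          η.toSignedMeasure = μ.toSignedMeasure + ν →
          ν univ = 0 →
          ν.totalVariation.support ⊆ μ.support →
          ν.toJordanDecomposition.negPart ≤ (2⁻¹ : ℝ≥0∞) • μ →
          wassersteinDist p η μ ≤
            ENNReal.ofReal (C * (tvNorm ν * Real.log ((tvNorm ν)⁻¹ + 1)))) := by
  have : StandardBorelSpace Ω := hΩ.measurableSet.standardBorel
  have hR : Metric.ediam Ω ≠ ∞ := hΩ.isBounded.ediam_ne_top
  have hX : ∀ x y : Ω, edist x y ≤ Metric.ediam Ω := fun x y =>
    Metric.edist_le_ediam_of_mem x.2 y.2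
  refine ⟨fun hne => ?_, fun heq => ?_⟩
  · exact hμ.exists_wassersteinDist_le_of_shiftCost hR hX hp.le hd
      (fun t => t ^ min 1 (1 / d + 1 / p)) (fun t ht => by positivity)
      fun c r hc hr => exists_shiftCost_le_rpow hp hd hc hr hne
  · exact hμ.exists_wassersteinDist_le_of_shiftCost hR hX hp.le hd
      (fun t => t * Real.log (t⁻¹ + 1))
      (fun t ht => mul_pos ht (Real.log_pos (by linarith [inv_pos.2 ht])))
      fun c r hc hr => exists_shiftCost_le_log hp hd hc hr heq
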